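/- For $1\le p\le\infty$ let $L_p=L_p[0,1]$ be the usual real Lebesgue space with its norm $\|\cdot\|_p$, and let $B_{L_p}=\{x\in L_p:\|x\|_p\le 1\}$ be its closed unit ball. Let $\alpha\in(0,1)$. (i) If $p\in\{1,\infty\}$, then there exists a map $T\colon B_{L_p}\to B_{L_p}$ that is uniformly $\alpha$-Hölder nonexpansive, that is, $$\|T^n x-T^n y\|_p\le\|x-y\|_p^{\alpha}\qquad\text{for all }x,y\in B_{L_p}\text{ and all integers } n\ge 1,$$ that has no fixed point, and that has null minimal displacement, that is, $\inf_{x\in B_{L_p}}\|x-Tx\|_p=0$. (ii) If $1<p<\infty$, then there exists a map $T\colon B_{L_p}\to B_{L_p}$ that is $\alpha$-Hölder nonexpansive, that is, $\|Tx-Ty\|_p\le\|x-y\|_p^{\alpha}$ for all $x,y\in B_{L_p}$, that has no fixed point, and that satisfies $\inf_{x\in B_{L_p}}\|x-Tx\|_p=0$. -/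

import Mathlib

open MeasureTheory
open scoped ENNReal

/-- A self-map `T` of a metric space is `α`-Hölder nonexpansive if
`ρ(T x, T y) ≤ ρ(x, y) ^ α` for all `x, y`. -/
def HolderNonexpansive {K : Type*} [MetricSpace K] (α : ℝ) (T : K → K) : Prop :=
  ∀ x y : K, dist (T x) (T y) ≤ dist x y ^ α

/-- A self-map `T` of a metric space is uniformly `α`-Hölder nonexpansive if every iterate
`T ^ n`, `n ≥ 1`, is `α`-Hölder nonexpansive. -/
def UniformlyHolderNonexpansive {K : Type*} [MetricSpace K] (α : ℝ) (T : K → K) : Prop :=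
  ∀ n : ℕ, 1 ≤ n → ∀ x y : K, dist (T^[n] x) (T^[n] y) ≤ dist x y ^ α

/-- The closed unit ball `B_X` of a normed space, as a metric space. -/
abbrev UnitBall (X : Type*) [NormedAddCommGroup X] : Type _ :=
  (Metric.closedBall (0 : X) 1 : Set X)

/-- The minimal displacement `d(T, B_X) = inf {‖x - T x‖ : x ∈ B_X}`. -/
noncomputable def minimalDisplacement {X : Type*} [NormedAddCommGroup X]
    (T : UnitBall X → UnitBall X) : ℝ :=
  ⨅ x : UnitBall X, ‖(x : X) - (T x : X)‖

/-- `B_X` fails the fixed point property for maps of the class `P` with null minimal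
displacement: some `T : B_X → B_X` in the class has no fixed point and `d(T, B_X) = 0`. -/
def UnitBallFailsFPP (X : Type*) [NormedAddCommGroup X]
    (P : (UnitBall X → UnitBall X) → Prop) : Prop :=
  ∃ T : UnitBall X → UnitBall X,
    P T ∧ Function.fixedPoints T = ∅ ∧ minimalDisplacement T = 0

/-- The real Lebesgue space `L_p = L_p[0,1]`. -/
abbrev LebesgueLp (p : ℝ≥0∞) : Type :=
  Lp ℝ p (volume.restrict (Set.Icc (0 : ℝ) 1))

section RadialRetraction

variable {E : Type*} [NormedAddCommGroup E] [NormedSpace ℝ E]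

/-- The radial retraction of a normed space onto its closed unit ball. -/
noncomputable def radialRetraction (x : E) : UnitBall E :=
  ⟨(max 1 ‖x‖)⁻¹ • x, by
    have h : 0 < max 1 ‖x‖ := lt_of_lt_of_le one_pos (le_max_left _ _)
    rw [mem_closedBall_zero_iff, norm_smul, norm_inv, Real.norm_of_nonneg h.le,
      inv_mul_le_iff₀ h, mul_one]
    exact le_max_right _ _⟩

lemma radialRetraction_coe (x : UnitBall E) : radialRetraction (x : E) = x := by
  have hx : ‖(x : E)‖ ≤ 1 := mem_closedBall_zero_iff.1 x.2
  apply Subtype.ext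
  simp [radialRetraction, max_eq_left hx]

lemma dist_radialRetraction_le (x y : E) :
    dist (radialRetraction x) (radialRetraction y) ≤ 2 * dist x y := by
  have ha : 1 ≤ max 1 ‖x‖ := le_max_left _ _
  have hb : 1 ≤ max 1 ‖y‖ := le_max_left _ _
  have hyb : ‖y‖ ≤ max 1 ‖y‖ := le_max_right _ _
  have hab : |max 1 ‖y‖ - max 1 ‖x‖| ≤ ‖x - y‖ := by
    refine (abs_max_sub_max_le_max 1 ‖y‖ 1 ‖x‖).trans ?_
    simp only [sub_self, abs_zero]
    refine max_le (norm_nonneg _) ?_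
    rw [norm_sub_rev]
    exact abs_norm_sub_norm_le _ _
  rw [Subtype.dist_eq, dist_eq_norm, dist_eq_norm]
  change ‖(max 1 ‖x‖)⁻¹ • x - (max 1 ‖y‖)⁻¹ • y‖ ≤ _
  set a := max 1 ‖x‖
  set b := max 1 ‖y‖
  have ha0 : 0 < a := by linarith
  have hb0 : 0 < b := by linarith
  have hsplit : a⁻¹ • x - b⁻¹ • y = a⁻¹ • ((x - y) + ((b - a) * b⁻¹) • y) := by
    rw [smul_add, smul_sub, smul_smul, sub_add, ← sub_smul]
    congr 2
    field_simp
    ring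
  rw [hsplit, norm_smul, norm_inv, Real.norm_of_nonneg ha0.le]
  have h1 : ‖((b - a) * b⁻¹) • y‖ ≤ ‖x - y‖ := by
    rw [norm_smul, norm_mul, Real.norm_eq_abs, norm_inv, Real.norm_of_nonneg hb0.le, mul_assoc]
    have : b⁻¹ * ‖y‖ ≤ 1 := by rwa [inv_mul_le_iff₀ hb0, mul_one]
    calc |b - a| * (b⁻¹ * ‖y‖) ≤ |b - a| * 1 := by gcongr
      _ ≤ ‖x - y‖ := by rwa [mul_one]
  calc a⁻¹ * ‖(x - y) + ((b - a) * b⁻¹) • y‖ ≤ 1 * (‖x - y‖ + ‖x - y‖) := by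
        gcongr
        · exact inv_le_one_of_one_le₀ ha
        · exact (norm_add_le _ _).trans (by gcongr)
    _ = 2 * ‖x - y‖ := by ring

end RadialRetraction

/-- A quantity bounded by a small constant and by a multiple of `d` is bounded by `d ^ α`. -/
lemma le_rpow_of_le_of_le_mul {α t δ K d : ℝ} (hα0 : 0 < α) (hα1 : α < 1) (ht : 0 ≤ t)
    (hδ : 0 ≤ δ) (hK : 0 ≤ K) (hd : 0 ≤ d) (htδ : t ≤ δ) (htd : t ≤ K * d)
    (h : δ ^ (1 - α) * K ^ α ≤ 1) : t ≤ d ^ α := by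
  calc t = t ^ (1 - α) * t ^ α := by
        rw [← Real.rpow_add_of_nonneg ht (by linarith) hα0.le]; simp
    _ ≤ δ ^ (1 - α) * (K * d) ^ α := by
        gcongr
    _ = (δ ^ (1 - α) * K ^ α) * d ^ α := by rw [Real.mul_rpow hK hd, mul_assoc]
    _ ≤ 1 * d ^ α := by gcongr
    _ = d ^ α := one_mul _

section Transfer

variable {E : Type*} [NormedAddCommGroup E] [NormedSpace ℝ E]

lemma exists_pos_scale {α : ℝ} (hα1 : α < 1) (K : ℝ) :
    ∃ r : ℝ, 0 < r ∧ r ≤ 1 ∧ (2 * r) ^ (1 - α) * K ^ α ≤ 1 := by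
  have hlim : Filter.Tendsto (fun r : ℝ => (2 * r) ^ (1 - α) * K ^ α)
      (nhdsWithin 0 (Set.Ioi 0)) (nhds 0) := by
    have hc : Continuous (fun r : ℝ => (2 * r) ^ (1 - α) * K ^ α) := by
      have := Real.continuous_rpow_const (q := 1 - α) (by linarith)
      fun_prop
    have h := (hc.tendsto 0).mono_left (nhdsWithin_le_nhds (s := Set.Ioi 0))
    simpa [Real.zero_rpow (by linarith : 1 - α ≠ 0)] using h
  have h1 := hlim.eventually (gt_mem_nhds one_pos)
  have h2 : ∀ᶠ r : ℝ in nhdsWithin 0 (Set.Ioi 0), r < 1 :=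
    nhdsWithin_le_nhds (gt_mem_nhds one_pos)
  obtain ⟨r, hr, hr1, hr0⟩ := (h1.and (h2.and self_mem_nhdsWithin)).exists
  exact ⟨r, hr0, hr1.le, hr.le⟩

/-- Rescaling: a fixed point free self-map of the unit ball with null minimal displacement yields
another one such that every iterate with Lipschitz constant `L` becomes `α`-Hölder nonexpansive. -/
theorem exists_holder_of_lipschitz {α L : ℝ} (hα0 : 0 < α) (hα1 : α < 1) (hL : 0 < L)
    (S : UnitBall E → UnitBall E) (hfix : ∀ x, S x ≠ x)
    (hdisp : ∀ ε > 0, ∃ x : UnitBall E, ‖(x : E) - S x‖ ≤ ε) :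
    ∃ T : UnitBall E → UnitBall E, Function.fixedPoints T = ∅ ∧ minimalDisplacement T = 0 ∧
      ∀ n : ℕ, 1 ≤ n → (∀ x y, dist (S^[n] x) (S^[n] y) ≤ L * dist x y) →
        ∀ x y, dist (T^[n] x) (T^[n] y) ≤ dist x y ^ α := by
  obtain ⟨r, hr0, hr1, hr⟩ := exists_pos_scale hα1 (2 * L)
  have hmem : ∀ x : UnitBall E, r • (x : E) ∈ Metric.closedBall (0 : E) 1 := fun x => by
    have hx : ‖(x : E)‖ ≤ 1 := mem_closedBall_zero_iff.1 x.2
    rw [mem_closedBall_zero_iff, norm_smul, Real.norm_of_nonneg hr0.le]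
    exact mul_le_one₀ hr1 (norm_nonneg _) hx
  let ι : UnitBall E → UnitBall E := fun x => ⟨r • (x : E), hmem x⟩
  let Q : UnitBall E → UnitBall E := fun x => radialRetraction (r⁻¹ • (x : E))
  have hQι : ∀ x, Q (ι x) = x := fun x => by
    change radialRetraction (r⁻¹ • (r • (x : E))) = x
    rw [smul_smul, inv_mul_cancel₀ hr0.ne', one_smul, radialRetraction_coe]
  have hι : ∀ x y, dist (ι x) (ι y) = r * dist x y := fun x y => by
    rw [Subtype.dist_eq, Subtype.dist_eq]
    change dist (r • (x : E)) (r • (y : E)) = _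
    rw [dist_smul₀, Real.norm_of_nonneg hr0.le]
  have hQ : ∀ x y, dist (Q x) (Q y) ≤ 2 * (r⁻¹ * dist x y) := fun x y => by
    refine (dist_radialRetraction_le _ _).trans ?_
    rw [dist_smul₀, norm_inv, Real.norm_of_nonneg hr0.le, Subtype.dist_eq]
  let T : UnitBall E → UnitBall E := fun x => ι (S (Q x))
  have hiter : ∀ n : ℕ, ∀ x, T^[n + 1] x = ι (S^[n + 1] (Q x)) := fun n x => by
    induction n with
    | zero => rfl
    | succ n ih =>
      rw [Function.iterate_succ_apply', ih, Function.iterate_succ_apply' S (n + 1)]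
      change ι (S (Q (ι _))) = _
      rw [hQι]
  have hball : ∀ x y : UnitBall E, dist x y ≤ 2 := fun x y => by
    have hx : ‖(x : E)‖ ≤ 1 := mem_closedBall_zero_iff.1 x.2
    have hy : ‖(y : E)‖ ≤ 1 := mem_closedBall_zero_iff.1 y.2
    rw [Subtype.dist_eq, dist_eq_norm]
    exact (norm_sub_le _ _).trans (by linarith)
  refine ⟨T, ?_, ?_, ?_⟩
  · refine Set.eq_empty_of_forall_notMem fun x hx => hfix (Q x) ?_
    have hx : ι (S (Q x)) = x := hx
    conv_rhs => rw [← hx]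
    rw [hQι]
  · have hbdd : BddBelow (Set.range fun x : UnitBall E => ‖(x : E) - (T x : E)‖) :=
      ⟨0, by rintro _ ⟨x, rfl⟩; exact norm_nonneg _⟩
    refine le_antisymm (le_of_forall_pos_le_add fun ε hε => ?_)
      (Real.iInf_nonneg fun x => norm_nonneg _)
    obtain ⟨x, hx⟩ := hdisp ε hε
    refine (ciInf_le hbdd (ι x)).trans ?_
    have : (T (ι x) : E) = r • (S x : E) := by
      change (ι (S (Q (ι x))) : E) = _
      rw [hQι]
    rw [this]
    change ‖r • (x : E) - r • (S x : E)‖ ≤ _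
    rw [← smul_sub, norm_smul, Real.norm_of_nonneg hr0.le, zero_add]
    exact (mul_le_of_le_one_left (norm_nonneg _) hr1).trans hx
  · intro n hn hS x y
    obtain ⟨n, rfl⟩ := Nat.exists_eq_add_of_le' hn
    rw [hiter, hiter, hι]
    refine le_rpow_of_le_of_le_mul (δ := 2 * r) (K := 2 * L) hα0 hα1 (by positivity)
      (by positivity) (by positivity) dist_nonneg ?_ ?_ hr
    · rw [mul_comm]
      exact mul_le_mul_of_nonneg_right (hball _ _) hr0.le
    · calc r * dist (S^[n + 1] (Q x)) (S^[n + 1] (Q y)) ≤ r * (L * (2 * (r⁻¹ * dist x y))) := by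
            gcongr
            exact (hS _ _).trans (by gcongr; exact hQ x y)
        _ = 2 * L * dist x y := by field_simp

lemma dist_iterate_le_of_dist_apply_apply_le {X : Type*} [PseudoMetricSpace X] {L : ℝ}
    {S : X → X} (h1 : ∀ x y, dist (S x) (S y) ≤ L * dist x y)
    (h2 : ∀ x y, dist (S (S x)) (S (S y)) ≤ dist (S x) (S y)) (n : ℕ) (hn : 1 ≤ n) (x y : X) :
    dist (S^[n] x) (S^[n] y) ≤ L * dist x y := by
  induction n, hn using Nat.le_induction with
  | base => exact h1 x y
  | succ n hn ih =>
    obtain ⟨n, rfl⟩ := Nat.exists_eq_add_of_le' hn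
    refine le_trans ?_ ih
    simp only [Function.iterate_succ_apply']
    exact h2 _ _

end Transfer

section KakutaniMap

variable {E : Type*} [NormedAddCommGroup E] [NormedSpace ℝ E] {V : E →ₗᵢ[ℝ] E} {g : E} {q : ℝ}

/-- Kakutani's map `x ↦ (1 - ‖x‖) g + V x` on the unit ball, for a linear isometry `V` whose range
is `q`-orthogonal to `g`. -/
def kakutaniMap (hq : 1 ≤ q) (hV : ∀ (a : ℝ) x, ‖a • g + V x‖ ^ q = |a| ^ q + ‖x‖ ^ q)
    (x : UnitBall E) : UnitBall E :=
  ⟨(1 - ‖(x : E)‖) • g + V x, by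
    have hx : ‖(x : E)‖ ≤ 1 := mem_closedBall_zero_iff.1 x.2
    have hx' : |1 - ‖(x : E)‖| = 1 - ‖(x : E)‖ := abs_of_nonneg (by linarith)
    rw [mem_closedBall_zero_iff]
    refine (Real.rpow_le_rpow_iff (norm_nonneg _) zero_le_one (by linarith : 0 < q)).1 ?_
    rw [hV, hx', Real.one_rpow]
    have h1 := Real.rpow_le_self_of_le_one (sub_nonneg.2 hx) (by linarith [norm_nonneg (x : E)]) hq
    have h2 := Real.rpow_le_self_of_le_one (norm_nonneg (x : E)) hx hq
    linarith⟩

variable (hq : 1 ≤ q) (hV : ∀ (a : ℝ) x, ‖a • g + V x‖ ^ q = |a| ^ q + ‖x‖ ^ q)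
include hq hV

lemma norm_eq_one_of_rpow_norm_add : ‖g‖ = 1 := by
  have hq0 : q ≠ 0 := by linarith
  have h := hV 1 0
  rw [map_zero, one_smul, add_zero, abs_one, norm_zero, Real.zero_rpow hq0, add_zero,
    Real.one_rpow] at h
  exact (Real.rpow_left_inj (norm_nonneg _) zero_le_one hq0).1 (by rw [h, Real.one_rpow])

lemma dist_kakutaniMap_le (x y : UnitBall E) :
    dist (kakutaniMap hq hV x) (kakutaniMap hq hV y) ≤ 2 * dist x y := by
  rw [Subtype.dist_eq, Subtype.dist_eq, dist_eq_norm, dist_eq_norm]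
  change ‖((1 - ‖(x : E)‖) • g + V x) - ((1 - ‖(y : E)‖) • g + V y)‖ ≤ _
  have : ((1 - ‖(x : E)‖) • g + V x) - ((1 - ‖(y : E)‖) • g + V y) =
      (‖(y : E)‖ - ‖(x : E)‖) • g + V ((x : E) - y) := by
    rw [map_sub]; module
  rw [this]
  refine (norm_add_le _ _).trans ?_
  rw [norm_smul, norm_eq_one_of_rpow_norm_add hq hV, mul_one, V.norm_map, two_mul]
  gcongr
  rw [norm_sub_rev]
  exact abs_norm_sub_norm_le _ _

lemma kakutaniMap_ne_self (hfix : ∀ x, V x = x → x = 0) (x : UnitBall E) :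
    kakutaniMap hq hV x ≠ x := by
  intro h
  have hx : (1 - ‖(x : E)‖) • g + V x = x := congrArg Subtype.val h
  have hn := hV (1 - ‖(x : E)‖) x
  rw [hx] at hn
  have h0 : |1 - ‖(x : E)‖| ^ q = 0 := by linarith
  rw [Real.rpow_eq_zero (abs_nonneg _) (by linarith), abs_eq_zero] at h0
  rw [h0, zero_smul, zero_add] at hx
  rw [hfix x hx, norm_zero] at h0
  norm_num at h0

lemma exists_norm_sub_kakutaniMap_le {ε : ℝ} (hε : 0 < ε) :
    ∃ x : UnitBall E, ‖(x : E) - kakutaniMap hq hV x‖ ≤ ε := by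
  have hq0 : 0 < q := by linarith
  have hg := norm_eq_one_of_rpow_norm_add hq hV
  let u : ℕ → E := fun n => Nat.rec 0 (fun _ x => g + V x) n
  have hu : ∀ n, u (n + 1) = g + V (u n) := fun n => rfl
  have hun : ∀ n : ℕ, ‖u n‖ ^ q = n := fun n => by
    induction n with
    | zero => simp [u, hq0.ne']
    | succ n ih =>
      have := hV 1 (u n)
      rw [one_smul, ih, abs_one, Real.one_rpow] at this
      rw [hu, this]; push_cast; ring
  have hstep : ∀ n, ‖u (n + 1) - u n‖ = 1 := fun n => by
    induction n with
    | zero => simp [u, hg]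
    | succ n ih =>
      rw [hu (n + 1)]
      conv_lhs => rw [hu n]
      rw [add_sub_add_left_eq_sub, ← map_sub, V.norm_map, ih]
  have hVu : ∀ n, ‖u n - V (u n)‖ ≤ 2 := fun n => by
    have : u n - V (u n) = g - (u (n + 1) - u n) := by rw [hu]; abel
    rw [this]
    refine (norm_sub_le _ _).trans ?_
    rw [hstep, hg]; norm_num
  obtain ⟨n, hn⟩ := exists_nat_gt ((2 / ε) ^ q)
  have hn0 : (0 : ℝ) < n := lt_of_le_of_lt (by positivity) hn
  have hpos : 0 < ‖u n‖ := by
    refine (norm_nonneg _).lt_of_ne fun h => ?_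
    have := hun n
    rw [← h, Real.zero_rpow hq0.ne'] at this
    linarith
  have hbig : 2 / ε ≤ ‖u n‖ := by
    refine (Real.rpow_le_rpow_iff (by positivity) hpos.le hq0).1 ?_
    rw [hun]; exact hn.le
  have hnorm : ‖‖u n‖⁻¹ • u n‖ = 1 := by
    rw [norm_smul, norm_inv, norm_norm, inv_mul_cancel₀ hpos.ne']
  refine ⟨⟨‖u n‖⁻¹ • u n, mem_closedBall_zero_iff.2 hnorm.le⟩, ?_⟩
  change ‖‖u n‖⁻¹ • u n - ((1 - ‖‖u n‖⁻¹ • u n‖) • g + V (‖u n‖⁻¹ • u n))‖ ≤ ε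
  rw [hnorm, sub_self, zero_smul, zero_add, map_smul, ← smul_sub, norm_smul, norm_inv, norm_norm,
    inv_mul_le_iff₀ hpos]
  refine (hVu n).trans ?_
  rwa [div_le_iff₀ hε] at hbig

/-- In the case `q = 1` Kakutani's map sends the ball into the sphere, where it is isometric. -/
lemma dist_kakutaniMap_kakutaniMap_le (hq1 : q = 1) (x y : UnitBall E) :
    dist (kakutaniMap hq hV (kakutaniMap hq hV x)) (kakutaniMap hq hV (kakutaniMap hq hV y)) ≤
      dist (kakutaniMap hq hV x) (kakutaniMap hq hV y) := by
  have hsphere : ∀ x : UnitBall E, ‖(kakutaniMap hq hV x : E)‖ = 1 := fun x => by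
    have hx : ‖(x : E)‖ ≤ 1 := mem_closedBall_zero_iff.1 x.2
    have h := hV (1 - ‖(x : E)‖) x
    rw [hq1, Real.rpow_one, Real.rpow_one, Real.rpow_one, abs_of_nonneg (sub_nonneg.2 hx)] at h
    change ‖(1 - ‖(x : E)‖) • g + V x‖ = 1
    rw [h]; ring
  have happ : ∀ x : UnitBall E,
      (kakutaniMap hq hV (kakutaniMap hq hV x) : E) = V (kakutaniMap hq hV x) := fun x => by
    change (1 - ‖(kakutaniMap hq hV x : E)‖) • g + V (kakutaniMap hq hV x) = _
    rw [hsphere, sub_self, zero_smul, zero_add]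
  rw [Subtype.dist_eq, Subtype.dist_eq, happ, happ, V.isometry.dist_eq]

end KakutaniMap

/-- Lebesgue measure on the unit interval. -/
local notation "μI" => (volume.restrict (Set.Icc (0 : ℝ) 1) : Measure ℝ)

section Dilation

lemma map_two_mul_restrict :
    ((μI).restrict (Set.Iic (1 / 2))).map (fun t => 2 * t) = (1 / 2 : ℝ≥0∞) • μI := by
  have hpre : Set.Iic (1 / 2) ∩ Set.Icc (0 : ℝ) 1 = (fun t => 2 * t) ⁻¹' Set.Icc 0 1 := by
    ext t
    simp only [Set.mem_inter_iff, Set.mem_Iic, Set.mem_Icc, Set.mem_preimage]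
    constructor <;> intro h <;> refine ⟨?_, ?_⟩ <;> grind
  rw [Measure.restrict_restrict measurableSet_Iic, hpre,
    ← Measure.restrict_map (measurable_const_mul 2) measurableSet_Icc,
    Real.map_volume_mul_left two_ne_zero, Measure.restrict_smul]
  congr 1
  rw [abs_of_pos (by norm_num), ENNReal.ofReal_inv_of_pos two_pos]
  simp

lemma map_half_mul_restrict :
    (μI).map (fun t => 2⁻¹ * t) = (2 : ℝ≥0∞) • (μI).restrict (Set.Iic (1 / 2)) := by
  have hpre : Set.Icc (0 : ℝ) 1 = (fun t => 2⁻¹ * t) ⁻¹' (Set.Iic (1 / 2) ∩ Set.Icc (0 : ℝ) 1) := by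
    ext t
    simp only [Set.mem_inter_iff, Set.mem_Iic, Set.mem_Icc, Set.mem_preimage]
    constructor <;> intro h <;> refine ⟨?_, ?_⟩ <;> grind
  conv_lhs => rw [hpre]
  rw [Measure.restrict_restrict measurableSet_Iic,
    ← Measure.restrict_map (measurable_const_mul _) (measurableSet_Iic.inter measurableSet_Icc),
    Real.map_volume_mul_left (by norm_num), Measure.restrict_smul]
  simp

lemma quasiMeasurePreserving_two_mul :
    Measure.QuasiMeasurePreserving (fun t : ℝ => 2 * t) ((μI).restrict (Set.Iic (1 / 2))) μI := by
  refine ⟨measurable_const_mul 2, ?_⟩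
  rw [map_two_mul_restrict]
  exact Measure.smul_absolutelyContinuous

lemma quasiMeasurePreserving_half_mul :
    Measure.QuasiMeasurePreserving (fun t : ℝ => 2⁻¹ * t) μI ((μI).restrict (Set.Iic (1 / 2))) := by
  refine ⟨measurable_const_mul _, ?_⟩
  rw [map_half_mul_restrict]
  exact Measure.smul_absolutelyContinuous

variable (p : ℝ≥0∞)

/-- The factor `2 ^ (1 / p)`, equal to `1` for `p = ∞`. -/
noncomputable def dilationFactor : ℝ := 2 ^ (1 / p).toReal

lemma dilationFactor_pos : 0 < dilationFactor p := Real.rpow_pos_of_pos two_pos _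

lemma enorm_dilationFactor_mul_half : ‖dilationFactor p‖ₑ * (1 / 2) ^ (1 / p).toReal = 1 := by
  rw [Real.enorm_of_nonneg (dilationFactor_pos p).le, dilationFactor,
    ← ENNReal.ofReal_rpow_of_pos two_pos, ← ENNReal.mul_rpow_of_nonneg _ _ ENNReal.toReal_nonneg]
  have : ENNReal.ofReal 2 * (1 / 2) = 1 := by
    rw [ENNReal.ofReal_ofNat, one_div, ENNReal.mul_inv_cancel two_ne_zero ENNReal.ofNat_ne_top]
  rw [this, ENNReal.one_rpow]

/-- The function underlying the dilation of `f`, living on `[0, 1/2]`. -/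
noncomputable def dilationFun (f : ℝ → ℝ) : ℝ → ℝ :=
  (Set.Iic (1 / 2)).indicator fun t => dilationFactor p * f (2 * t)

variable {p}

lemma dilationFun_of_le {f : ℝ → ℝ} {t : ℝ} (ht : t ≤ 1 / 2) :
    dilationFun p f t = dilationFactor p * f (2 * t) :=
  Set.indicator_of_mem (s := Set.Iic (1 / 2 : ℝ)) ht _

lemma dilationFun_of_not_le {f : ℝ → ℝ} {t : ℝ} (ht : ¬ t ≤ 1 / 2) : dilationFun p f t = 0 :=
  Set.indicator_of_notMem (s := Set.Iic (1 / 2 : ℝ)) ht _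

lemma dilationFun_congr {f h : ℝ → ℝ} (hfh : f =ᵐ[μI] h) :
    dilationFun p f =ᵐ[μI] dilationFun p h := by
  have h1 := (ae_restrict_iff' measurableSet_Iic).1 (quasiMeasurePreserving_two_mul.ae_eq_comp hfh)
  filter_upwards [h1] with t ht
  by_cases hm : t ∈ Set.Iic (1 / 2 : ℝ)
  · have := ht hm
    simp only [Function.comp_apply] at this
    simp only [dilationFun, Set.indicator_of_mem hm, this]
  · simp only [dilationFun, Set.indicator_of_notMem hm]

lemma eLpNorm_dilationFun {f : ℝ → ℝ} (hf : AEStronglyMeasurable f μI) :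
    eLpNorm (dilationFun p f) p μI = eLpNorm f p μI := by
  have hmap : eLpNorm (fun t => f (2 * t)) p ((μI).restrict (Set.Iic (1 / 2))) =
      (1 / 2) ^ (1 / p).toReal * eLpNorm f p μI := by
    rw [← smul_eq_mul, ← eLpNorm_smul_measure_of_ne_zero (by simp), ← map_two_mul_restrict,
      eLpNorm_map_measure _ (measurable_const_mul 2).aemeasurable]
    · rfl
    · rw [map_two_mul_restrict]; exact hf.smul_measure _
  have hmul : (fun t => dilationFactor p * f (2 * t)) =
    dilationFactor p • fun t => f (2 * t) := rfl
  rw [dilationFun, eLpNorm_indicator_eq_eLpNorm_restrict measurableSet_Iic, hmul,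
    eLpNorm_const_smul, hmap, ← mul_assoc, enorm_dilationFactor_mul_half, one_mul]

lemma aestronglyMeasurable_dilationFun {f : ℝ → ℝ} (hf : AEStronglyMeasurable f μI) :
    AEStronglyMeasurable (dilationFun p f) μI := by
  rw [dilationFun, aestronglyMeasurable_indicator_iff measurableSet_Iic]
  exact (hf.comp_quasiMeasurePreserving quasiMeasurePreserving_two_mul).const_mul _

lemma memLp_dilationFun {f : ℝ → ℝ} (hf : MemLp f p μI) : MemLp (dilationFun p f) p μI :=
  ⟨aestronglyMeasurable_dilationFun hf.1, by rw [eLpNorm_dilationFun hf.1]; exact hf.2⟩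

variable [Fact (1 ≤ p)]

variable (p) in
/-- The isometric dilation `f ↦ 2 ^ (1 / p) f (2 ·)` of `L_p[0,1]` into the functions supported
on `[0, 1/2]`. -/
noncomputable def dilation : LebesgueLp p →ₗᵢ[ℝ] LebesgueLp p where
  toFun f := MemLp.toLp (dilationFun p f) (memLp_dilationFun (Lp.memLp f))
  map_add' f h := by
    rw [← MemLp.toLp_add, MemLp.toLp_eq_toLp_iff]
    refine (dilationFun_congr (Lp.coeFn_add f h)).trans (Filter.Eventually.of_forall fun t => ?_)
    by_cases hm : t ∈ Set.Iic (1 / 2 : ℝ)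
    · simp only [dilationFun, Set.indicator_of_mem hm, Pi.add_apply, mul_add]
    · simp only [dilationFun, Set.indicator_of_notMem hm, Pi.add_apply, add_zero]
  map_smul' a f := by
    rw [RingHom.id_apply, ← MemLp.toLp_const_smul, MemLp.toLp_eq_toLp_iff]
    refine (dilationFun_congr (Lp.coeFn_smul a f)).trans (Filter.Eventually.of_forall fun t => ?_)
    by_cases hm : t ∈ Set.Iic (1 / 2 : ℝ)
    · simp only [dilationFun, Set.indicator_of_mem hm, Pi.smul_apply, smul_eq_mul]
      ring
    · simp only [dilationFun, Set.indicator_of_notMem hm, Pi.smul_apply, smul_zero]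
  norm_map' f := by
    change ‖MemLp.toLp (dilationFun p f) (memLp_dilationFun (Lp.memLp f))‖ = ‖f‖
    rw [Lp.norm_toLp, eLpNorm_dilationFun (Lp.memLp f).1, Lp.norm_def]

lemma coeFn_dilation (f : LebesgueLp p) : dilation p f =ᵐ[μI] dilationFun p f :=
  (memLp_dilationFun (Lp.memLp f)).coeFn_toLp

variable (p) in
/-- The normalized indicator function of `(1/2, 1]`. -/
noncomputable def rightHalf : LebesgueLp p :=
  indicatorConstLp p (measurableSet_Ioi (a := (1 / 2 : ℝ))) (measure_ne_top _ _) (dilationFactor p)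

omit [Fact (1 ≤ p)] in
lemma coeFn_rightHalf :
    rightHalf p =ᵐ[μI] (Set.Ioi (1 / 2)).indicator fun _ => dilationFactor p :=
  indicatorConstLp_coeFn

lemma measure_Ioi_half : (μI) (Set.Ioi (1 / 2)) = 1 / 2 := by
  rw [Measure.restrict_apply measurableSet_Ioi]
  have : Set.Ioi (1 / 2) ∩ Set.Icc (0 : ℝ) 1 = Set.Ioc (1 / 2) 1 := by
    ext t
    simp only [Set.mem_inter_iff, Set.mem_Ioi, Set.mem_Icc, Set.mem_Ioc]
    constructor <;> intro h <;> refine ⟨?_, ?_⟩ <;> grind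
  rw [this, Real.volume_Ioc]
  rw [show (1 - 1 / 2 : ℝ) = 2⁻¹ by norm_num, ENNReal.ofReal_inv_of_pos two_pos]
  simp

lemma norm_rightHalf : ‖rightHalf p‖ = 1 := by
  have hp : p ≠ 0 := (zero_lt_one.trans_le (Fact.out : 1 ≤ p)).ne'
  rw [Lp.norm_def, eLpNorm_congr_ae coeFn_rightHalf,
    eLpNorm_indicator_const' measurableSet_Ioi (by rw [measure_Ioi_half]; simp) hp,
    measure_Ioi_half]
  have := enorm_dilationFactor_mul_half p
  rw [one_div p, ENNReal.toReal_inv, ← one_div p.toReal] at this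
  rw [this, ENNReal.toReal_one]

lemma enorm_rpow_eq_lintegral (hp : p ≠ ∞) (f : LebesgueLp p) :
    ‖f‖ₑ ^ p.toReal = ∫⁻ t, ‖f t‖ₑ ^ p.toReal ∂μI := by
  have hp0 : p ≠ 0 := (zero_lt_one.trans_le (Fact.out : 1 ≤ p)).ne'
  rw [Lp.enorm_def, eLpNorm_eq_lintegral_rpow_enorm_toReal hp0 hp, ← ENNReal.rpow_mul, one_div,
    inv_mul_cancel₀ (ENNReal.toReal_pos hp0 hp).ne', ENNReal.rpow_one]

lemma norm_add_rpow_of_disjoint (hp : p ≠ ∞) {f h : LebesgueLp p}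
    (hfh : ∀ᵐ t ∂μI, f t = 0 ∨ h t = 0) :
    ‖f + h‖ ^ p.toReal = ‖f‖ ^ p.toReal + ‖h‖ ^ p.toReal := by
  have hp0 : p ≠ 0 := (zero_lt_one.trans_le (Fact.out : 1 ≤ p)).ne'
  have hq := ENNReal.toReal_pos hp0 hp
  have key : ‖f + h‖ₑ ^ p.toReal = ‖f‖ₑ ^ p.toReal + ‖h‖ₑ ^ p.toReal := by
    rw [enorm_rpow_eq_lintegral hp, enorm_rpow_eq_lintegral hp, enorm_rpow_eq_lintegral hp,
      ← lintegral_add_left' ((Lp.aestronglyMeasurable f).enorm.pow_const _)]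
    refine lintegral_congr_ae ?_
    filter_upwards [hfh, Lp.coeFn_add f h] with t ht ha
    rw [ha, Pi.add_apply]
    rcases ht with h0 | h0 <;> simp [h0, hq]
  have := congrArg ENNReal.toReal key
  rwa [ENNReal.toReal_add (by simp [hq.le]) (by simp [hq.le]), ← ENNReal.toReal_rpow,
    ← ENNReal.toReal_rpow, ← ENNReal.toReal_rpow, toReal_enorm, toReal_enorm, toReal_enorm] at this

lemma norm_smul_rightHalf_add_dilation_rpow (hp : p ≠ ∞) (a : ℝ) (f : LebesgueLp p) :
    ‖a • rightHalf p + dilation p f‖ ^ p.toReal = |a| ^ p.toReal + ‖f‖ ^ p.toReal := by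
  rw [norm_add_rpow_of_disjoint hp, norm_smul, norm_rightHalf, mul_one, LinearIsometry.norm_map,
    Real.norm_eq_abs]
  filter_upwards [Lp.coeFn_smul a (rightHalf p), coeFn_rightHalf (p := p), coeFn_dilation f]
    with t h1 h2 h3
  rw [h1, h3, Pi.smul_apply, h2]
  by_cases ht : t ≤ 1 / 2
  · left
    rw [Set.indicator_of_notMem (by simpa using ht), smul_zero]
  · exact Or.inr (dilationFun_of_not_le ht)

lemma eq_zero_of_dilation_eq_self {f : LebesgueLp p} (hf : dilation p f = f) : f = 0 := by
  have hmeas : MeasurableSet {t | f t ≠ 0} :=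
    (Lp.stronglyMeasurable f).measurable (measurableSet_singleton 0).compl
  have hset : (μI) {t | f t ≠ 0} = 1 / 2 * (μI) {t | f t ≠ 0} := by
    calc (μI) {t | f t ≠ 0} = (μI) ({t | f (2 * t) ≠ 0} ∩ Set.Iic (1 / 2)) := by
          refine measure_congr ?_
          have h := coeFn_dilation f
          rw [hf] at h
          filter_upwards [h] with t ht
          refine propext ?_
          change f t ≠ 0 ↔ (f (2 * t) ≠ 0 ∧ t ≤ 1 / 2)
          rw [ht]
          by_cases hm : t ≤ 1 / 2
          · rw [dilationFun_of_le hm]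
            simp only [ne_eq, mul_eq_zero, (dilationFactor_pos p).ne', false_or, hm, and_true]
          · rw [dilationFun_of_not_le hm]
            simp only [ne_eq, not_true_eq_false, hm, and_false]
      _ = (((μI).restrict (Set.Iic (1 / 2))).map (fun t => 2 * t)) {t | f t ≠ 0} := by
          rw [Measure.map_apply (measurable_const_mul 2) hmeas,
            Measure.restrict_apply (measurable_const_mul 2 hmeas)]
          rfl
      _ = 1 / 2 * (μI) {t | f t ≠ 0} := by
          rw [map_two_mul_restrict, Measure.smul_apply, smul_eq_mul]
  have hzero : (μI) {t | f t ≠ 0} = 0 := by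
    by_contra hne
    have hlt := ENNReal.half_lt_self hne (measure_ne_top _ _)
    rw [ENNReal.div_eq_inv_mul, ← one_div] at hlt
    exact hlt.ne hset.symm
  exact (Lp.eq_zero_iff_ae_eq_zero).2 hzero

end Dilation

section EssentiallyBounded

lemma ae_abs_le_norm (f : LebesgueLp ∞) : ∀ᵐ t ∂μI, |f t| ≤ ‖f‖ := by
  filter_upwards [ae_le_eLpNormEssSup (f := f) (μ := μI)] with t ht
  rw [← eLpNorm_exponent_top] at ht
  have := ENNReal.toReal_mono (Lp.eLpNorm_ne_top f) ht
  rwa [toReal_enorm, Real.norm_eq_abs] at this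

lemma norm_le_of_ae_abs_le {f : LebesgueLp ∞} {C : ℝ} (hC : 0 ≤ C)
    (h : ∀ᵐ t ∂μI, |f t| ≤ C) : ‖f‖ ≤ C := by
  simpa using Lp.norm_le_of_ae_bound (p := ∞) (f := f) hC h

lemma quasiMeasurePreserving_half_mul_self :
    Measure.QuasiMeasurePreserving (fun t : ℝ => 2⁻¹ * t) μI μI :=
  quasiMeasurePreserving_half_mul.mono_right Measure.absolutelyContinuous_restrict

lemma memLp_comp_half_mul (f : LebesgueLp ∞) : MemLp (fun t => f (2⁻¹ * t)) ∞ μI :=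
  memLp_top_of_bound
    ((Lp.aestronglyMeasurable f).comp_quasiMeasurePreserving quasiMeasurePreserving_half_mul_self)
    ‖f‖ (quasiMeasurePreserving_half_mul_self.ae (ae_abs_le_norm f))

/-- The restriction of `f` to `[0, 1/2]`, stretched to the unit interval. -/
noncomputable def stretch : LebesgueLp ∞ →ₗ[ℝ] LebesgueLp ∞ where
  toFun f := (memLp_comp_half_mul f).toLp fun t => f (2⁻¹ * t)
  map_add' f h := by
    rw [← MemLp.toLp_add, MemLp.toLp_eq_toLp_iff]
    exact quasiMeasurePreserving_half_mul_self.ae_eq_comp (Lp.coeFn_add f h)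
  map_smul' a f := by
    rw [RingHom.id_apply, ← MemLp.toLp_const_smul, MemLp.toLp_eq_toLp_iff]
    exact quasiMeasurePreserving_half_mul_self.ae_eq_comp (Lp.coeFn_smul a f)

lemma coeFn_stretch (f : LebesgueLp ∞) : stretch f =ᵐ[μI] fun t => f (2⁻¹ * t) :=
  (memLp_comp_half_mul f).coeFn_toLp

lemma norm_stretch_le (f : LebesgueLp ∞) : ‖stretch f‖ ≤ ‖f‖ := by
  refine norm_le_of_ae_abs_le (norm_nonneg _) ?_
  filter_upwards [coeFn_stretch f,
    quasiMeasurePreserving_half_mul_self.ae (ae_abs_le_norm f)] with t h1 h2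
  rwa [h1]

lemma norm_stretch_pow_le (n : ℕ) (f : LebesgueLp ∞) : ‖(stretch ^ n) f‖ ≤ ‖f‖ := by
  induction n with
  | zero => simp
  | succ n ih =>
    rw [pow_succ', Module.End.mul_apply]
    exact (norm_stretch_le _).trans ih

lemma dilationFactor_top : dilationFactor ∞ = 1 := by simp [dilationFactor]

lemma ae_le_one : ∀ᵐ t ∂μI, t ≤ 1 := by
  filter_upwards [ae_restrict_mem measurableSet_Icc] with t ht using ht.2

lemma stretch_dilation (f : LebesgueLp ∞) : stretch (dilation ∞ f) = f := by
  refine Lp.ext ?_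
  filter_upwards [coeFn_stretch (dilation ∞ f),
    quasiMeasurePreserving_half_mul_self.ae (coeFn_dilation f), ae_le_one] with t h1 h2 ht
  rw [h1, h2, dilationFun_of_le (by linarith), dilationFactor_top, one_mul,
    mul_inv_cancel_left₀ two_ne_zero]

lemma stretch_rightHalf : stretch (rightHalf ∞) = 0 := by
  refine (Lp.eq_zero_iff_ae_eq_zero).2 ?_
  filter_upwards [coeFn_stretch (rightHalf ∞),
    quasiMeasurePreserving_half_mul_self.ae (coeFn_rightHalf (p := ∞)), ae_le_one] with t h1 h2 ht
  rw [h1, h2, Set.indicator_of_notMem]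
  · rfl
  · rw [Set.mem_Ioi, not_lt]; linarith

lemma stretch_compLp {c : NNReal} {φ : ℝ → ℝ} (hφ : LipschitzWith c φ) (h0 : φ 0 = 0)
    (f : LebesgueLp ∞) : stretch (hφ.compLp h0 f) = hφ.compLp h0 (stretch f) := by
  refine Lp.ext ?_
  filter_upwards [coeFn_stretch (hφ.compLp h0 f), coeFn_stretch f,
    hφ.coeFn_compLp h0 (stretch f),
    quasiMeasurePreserving_half_mul_self.ae (hφ.coeFn_compLp h0 f)] with t h1 h2 h3 h4
  rw [h1, h3, h4, Function.comp_apply, Function.comp_apply, h2]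

lemma stretch_pow_compLp {c : NNReal} {φ : ℝ → ℝ} (hφ : LipschitzWith c φ) (h0 : φ 0 = 0)
    (n : ℕ) (f : LebesgueLp ∞) :
    (stretch ^ n) (hφ.compLp h0 f) = hφ.compLp h0 ((stretch ^ n) f) := by
  induction n with
  | zero => simp
  | succ n ih => rw [pow_succ', Module.End.mul_apply, ih, stretch_compLp, Module.End.mul_apply]

/-- The limit superior of `|f|` at `0`, computed as the limit of the norms of `f` restricted to
`[0, 2 ^ (-n)]`. -/
noncomputable def essLimsupAtZero (f : LebesgueLp ∞) : ℝ := ⨅ n : ℕ, ‖(stretch ^ n) f‖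

lemma essLimsupAtZero_nonneg (f : LebesgueLp ∞) : 0 ≤ essLimsupAtZero f :=
  Real.iInf_nonneg fun _ => norm_nonneg _

lemma essLimsupAtZero_le (f : LebesgueLp ∞) (n : ℕ) : essLimsupAtZero f ≤ ‖(stretch ^ n) f‖ :=
  ciInf_le ⟨0, by rintro _ ⟨n, rfl⟩; exact norm_nonneg _⟩ n

lemma abs_essLimsupAtZero_sub_le (f h : LebesgueLp ∞) :
    |essLimsupAtZero f - essLimsupAtZero h| ≤ ‖f - h‖ := by
  have key : ∀ f h : LebesgueLp ∞, essLimsupAtZero f - ‖f - h‖ ≤ essLimsupAtZero h := fun f h => by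
    refine le_ciInf fun n => ?_
    have h1 := essLimsupAtZero_le f n
    have h2 := norm_stretch_pow_le n (f - h)
    rw [map_sub] at h2
    have h3 := norm_sub_norm_le ((stretch ^ n) f) ((stretch ^ n) h)
    linarith
  have h1 := key f h
  have h2 := key h f
  rw [norm_sub_rev] at h2
  rw [abs_le]
  constructor <;> linarith

lemma essLimsupAtZero_stretch (f : LebesgueLp ∞) :
    essLimsupAtZero (stretch f) = essLimsupAtZero f := by
  refine le_antisymm (le_ciInf fun n => ?_) (le_ciInf fun n => ?_)
  · refine (essLimsupAtZero_le _ n).trans ?_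
    rw [← Module.End.mul_apply, ← pow_succ, pow_succ', Module.End.mul_apply]
    exact norm_stretch_le _
  · rw [← Module.End.mul_apply, ← pow_succ]
    exact essLimsupAtZero_le f (n + 1)

lemma essLimsupAtZero_eq_zero_of_stretch_pow {f : LebesgueLp ∞} {n : ℕ}
    (h : (stretch ^ n) f = 0) : essLimsupAtZero f = 0 := by
  refine le_antisymm ?_ (essLimsupAtZero_nonneg f)
  simpa [h] using essLimsupAtZero_le f n

lemma essLimsupAtZero_eq_norm_of_stretch_eq_self {f : LebesgueLp ∞} (h : stretch f = f) :
    essLimsupAtZero f = ‖f‖ := by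
  have hn : ∀ n : ℕ, (stretch ^ n) f = f := fun n => by
    induction n with
    | zero => simp
    | succ n ih => rw [pow_succ, Module.End.mul_apply, h, ih]
  simp [essLimsupAtZero, hn]

/-- Soft thresholding of the real line at level `c`. -/
noncomputable def softThreshold (c t : ℝ) : ℝ := max (t - c) 0 - max (-t - c) 0

lemma abs_softThreshold_sub_le (c d s t : ℝ) :
    |softThreshold c s - softThreshold d t| ≤ 2 * (|s - t| + |c - d|) := by
  have key : ∀ s t : ℝ, |max (s - c) 0 - max (t - d) 0| ≤ |s - t| + |c - d| := fun s t => by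
    have h := abs_max_sub_max_le_abs (s - c) (t - d) 0
    rw [show s - c - (t - d) = (s - t) - (c - d) by ring] at h
    exact h.trans (abs_sub _ _)
  have h1 := key s t
  have h2 := key (-s) (-t)
  rw [show -s - -t = -(s - t) by ring, abs_neg] at h2
  have : softThreshold c s - softThreshold d t =
      (max (s - c) 0 - max (t - d) 0) - (max (-s - c) 0 - max (-t - d) 0) := by
    simp only [softThreshold]; ring
  rw [this]
  refine (abs_sub _ _).trans ?_
  linarith

lemma lipschitzWith_softThreshold (c : ℝ) : LipschitzWith 2 (softThreshold c) :=
  LipschitzWith.of_dist_le_mul fun s t => by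
    simpa [Real.dist_eq] using abs_softThreshold_sub_le c c s t

lemma softThreshold_apply_zero (c : ℝ) : softThreshold c 0 = 0 := by
  simp [softThreshold]

lemma softThreshold_zero (t : ℝ) : softThreshold 0 t = t := by
  simp only [softThreshold]
  grind

lemma abs_softThreshold_le {c t M : ℝ} (ht : |t| ≤ M + c) (hM : 0 ≤ M) :
    |softThreshold c t| ≤ M := by
  rw [abs_le] at ht ⊢
  simp only [softThreshold]
  grind

/-- The retraction `f ↦ sign f (|f| - c)⁺`, `c` the limit superior of `|f|` at `0`, onto the
functions in `L_∞` which tend to `0` at `0`. -/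
noncomputable def vanishingRetraction (f : LebesgueLp ∞) : LebesgueLp ∞ :=
  (lipschitzWith_softThreshold (essLimsupAtZero f)).compLp
    (softThreshold_apply_zero _) f

lemma coeFn_vanishingRetraction (f : LebesgueLp ∞) :
    vanishingRetraction f =ᵐ[μI] fun t => softThreshold (essLimsupAtZero f) (f t) :=
  LipschitzWith.coeFn_compLp _ _ _

lemma norm_compLp_softThreshold_le {c M : ℝ} (hM : 0 ≤ M) {f : LebesgueLp ∞}
    (hf : ‖f‖ ≤ M + c) :
    ‖(lipschitzWith_softThreshold c).compLp (softThreshold_apply_zero c) f‖ ≤ M := by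
  refine norm_le_of_ae_abs_le hM ?_
  filter_upwards [(lipschitzWith_softThreshold c).coeFn_compLp (softThreshold_apply_zero c) f,
    ae_abs_le_norm f] with t h1 h2
  rw [h1]
  exact abs_softThreshold_le (h2.trans hf) hM

lemma norm_vanishingRetraction_le (f : LebesgueLp ∞) : ‖vanishingRetraction f‖ ≤ ‖f‖ :=
  norm_compLp_softThreshold_le (norm_nonneg _)
    (le_add_of_nonneg_right (essLimsupAtZero_nonneg f))

lemma essLimsupAtZero_vanishingRetraction (f : LebesgueLp ∞) :
    essLimsupAtZero (vanishingRetraction f) = 0 := by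
  refine le_antisymm (le_of_forall_pos_le_add fun ε hε => ?_) (essLimsupAtZero_nonneg _)
  obtain ⟨n, hn⟩ := exists_lt_of_ciInf_lt
    (show essLimsupAtZero f < ε + essLimsupAtZero f by linarith)
  refine (essLimsupAtZero_le _ n).trans ?_
  rw [vanishingRetraction, stretch_pow_compLp, zero_add]
  exact norm_compLp_softThreshold_le hε.le hn.le

lemma vanishingRetraction_eq_self {f : LebesgueLp ∞} (hf : essLimsupAtZero f = 0) :
    vanishingRetraction f = f := by
  refine Lp.ext ?_
  filter_upwards [coeFn_vanishingRetraction f] with t h1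
  rw [h1, hf, softThreshold_zero]

lemma norm_vanishingRetraction_sub_le (f h : LebesgueLp ∞) :
    ‖vanishingRetraction f - vanishingRetraction h‖ ≤ 4 * ‖f - h‖ := by
  refine norm_le_of_ae_abs_le (by positivity) ?_
  filter_upwards [Lp.coeFn_sub (vanishingRetraction f) (vanishingRetraction h),
    coeFn_vanishingRetraction f, coeFn_vanishingRetraction h, Lp.coeFn_sub f h,
    ae_abs_le_norm (f - h)] with t h1 h2 h3 h4 h5
  rw [h4, Pi.sub_apply] at h5
  rw [h1, Pi.sub_apply, h2, h3]
  refine (abs_softThreshold_sub_le _ _ _ _).trans ?_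
  linarith [abs_essLimsupAtZero_sub_le f h]

lemma norm_rightHalf_add_dilation_le {f : LebesgueLp ∞} (hf : ‖f‖ ≤ 1) :
    ‖rightHalf ∞ + dilation ∞ f‖ ≤ 1 := by
  refine norm_le_of_ae_abs_le zero_le_one ?_
  filter_upwards [Lp.coeFn_add (rightHalf ∞) (dilation ∞ f), coeFn_rightHalf (p := ∞),
    coeFn_dilation f, ae_abs_le_norm (dilation ∞ f)] with t h1 h2 h3 h4
  rw [LinearIsometry.norm_map] at h4
  rw [h1, Pi.add_apply, h2]
  by_cases ht : t ≤ 1 / 2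
  · rw [Set.indicator_of_notMem (by simpa using ht), zero_add]
    exact h4.trans hf
  · rw [h3, dilationFun_of_not_le ht, add_zero,
      Set.indicator_of_mem (Set.mem_Ioi.2 (not_le.1 ht)), dilationFactor_top, abs_one]

lemma stretch_rightHalf_add_dilation (f : LebesgueLp ∞) :
    stretch (rightHalf ∞ + dilation ∞ f) = f := by
  rw [map_add, stretch_rightHalf, stretch_dilation, zero_add]

/-- The right shift `f ↦ 1_{(1/2, 1]} + f (2 ·)` precomposed with the retraction onto the functions
which tend to `0` at `0`. -/
noncomputable def shiftMap (x : UnitBall (LebesgueLp ∞)) : UnitBall (LebesgueLp ∞) :=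
  ⟨rightHalf ∞ + dilation ∞ (vanishingRetraction x), mem_closedBall_zero_iff.2
    (norm_rightHalf_add_dilation_le
      ((norm_vanishingRetraction_le _).trans (mem_closedBall_zero_iff.1 x.2)))⟩

lemma coe_shiftMap (x : UnitBall (LebesgueLp ∞)) :
    (shiftMap x : LebesgueLp ∞) = rightHalf ∞ + dilation ∞ (vanishingRetraction x) := rfl

lemma dist_shiftMap (x y : UnitBall (LebesgueLp ∞)) : dist (shiftMap x) (shiftMap y) =
    dist (vanishingRetraction x) (vanishingRetraction y) := by
  rw [Subtype.dist_eq, coe_shiftMap, coe_shiftMap, dist_add_left, (dilation ∞).isometry.dist_eq]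

lemma essLimsupAtZero_shiftMap (x : UnitBall (LebesgueLp ∞)) :
    essLimsupAtZero (shiftMap x) = 0 := by
  rw [coe_shiftMap, ← essLimsupAtZero_stretch, stretch_rightHalf_add_dilation,
    essLimsupAtZero_vanishingRetraction]

lemma dist_shiftMap_le (x y : UnitBall (LebesgueLp ∞)) :
    dist (shiftMap x) (shiftMap y) ≤ 4 * dist x y := by
  rw [dist_shiftMap, Subtype.dist_eq, dist_eq_norm, dist_eq_norm]
  exact norm_vanishingRetraction_sub_le _ _

lemma dist_shiftMap_shiftMap_le (x y : UnitBall (LebesgueLp ∞)) :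
    dist (shiftMap (shiftMap x)) (shiftMap (shiftMap y)) ≤ dist (shiftMap x) (shiftMap y) := by
  rw [dist_shiftMap, vanishingRetraction_eq_self (essLimsupAtZero_shiftMap x),
    vanishingRetraction_eq_self (essLimsupAtZero_shiftMap y), Subtype.dist_eq]

lemma shiftMap_ne_self (x : UnitBall (LebesgueLp ∞)) : shiftMap x ≠ x := by
  intro h
  have h0 : essLimsupAtZero (x : LebesgueLp ∞) = 0 := by
    have := essLimsupAtZero_shiftMap x
    rwa [h] at this
  have hx : rightHalf ∞ + dilation ∞ (x : LebesgueLp ∞) = x := by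
    have := coe_shiftMap x
    rw [h, vanishingRetraction_eq_self h0] at this
    exact this.symm
  have hstretch : stretch (x : LebesgueLp ∞) = x := by
    conv_lhs => rw [← hx]
    exact stretch_rightHalf_add_dilation _
  rw [essLimsupAtZero_eq_norm_of_stretch_eq_self hstretch, norm_eq_zero] at h0
  rw [h0, map_zero, add_zero] at hx
  have := norm_rightHalf (p := ∞)
  rw [hx, norm_zero] at this
  exact zero_ne_one this

lemma exists_norm_sub_shiftMap_le {ε : ℝ} (hε : 0 < ε) :
    ∃ x : UnitBall (LebesgueLp ∞), ‖(x : LebesgueLp ∞) - shiftMap x‖ ≤ ε := by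
  let u : ℕ → LebesgueLp ∞ := fun n => Nat.rec 0 (fun _ x => rightHalf ∞ + dilation ∞ x) n
  have hu : ∀ n, u (n + 1) = rightHalf ∞ + dilation ∞ (u n) := fun n => rfl
  have hun : ∀ n, ‖u n‖ ≤ 1 := fun n => by
    induction n with
    | zero => simp [u]
    | succ n ih => rw [hu]; exact norm_rightHalf_add_dilation_le ih
  have hzero : ∀ n k, k ≤ n → (stretch ^ n) (u k) = 0 := fun n => by
    induction n with
    | zero => intro k hk; rw [Nat.le_zero.1 hk]; exact map_zero _
    | succ n ih =>
      rintro (_ | k) hk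
      · exact map_zero _
      · rw [pow_succ, Module.End.mul_apply, hu, stretch_rightHalf_add_dilation]
        exact ih k (by lia)
  obtain ⟨n, hn⟩ := exists_nat_gt ε⁻¹
  have hn0 : (0 : ℝ) < n := lt_trans (inv_pos.2 hε) hn
  let a : LebesgueLp ∞ := (n : ℝ)⁻¹ • ∑ k ∈ Finset.range n, u k
  have ha : ‖a‖ ≤ 1 := by
    rw [norm_smul, norm_inv, Real.norm_of_nonneg hn0.le, inv_mul_le_iff₀ hn0, mul_one]
    refine (norm_sum_le_of_le _ fun k _ => hun k).trans ?_
    simp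
  have hd : essLimsupAtZero a = 0 := by
    refine essLimsupAtZero_eq_zero_of_stretch_pow (n := n) ?_
    rw [map_smul, map_sum, Finset.sum_eq_zero, smul_zero]
    exact fun k hk => hzero n k (Finset.mem_range.1 hk).le
  refine ⟨⟨a, mem_closedBall_zero_iff.2 ha⟩, ?_⟩
  rw [coe_shiftMap]
  change ‖a - (rightHalf ∞ + dilation ∞ (vanishingRetraction a))‖ ≤ ε
  have hdiff : rightHalf ∞ + dilation ∞ a - a = (n : ℝ)⁻¹ • u n := by
    have htel : ∑ k ∈ Finset.range n, (u (k + 1) - u k) = u n := by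
      rw [Finset.sum_range_sub]; exact sub_zero _
    have hg : rightHalf ∞ = (n : ℝ)⁻¹ • ∑ _k ∈ Finset.range n, rightHalf ∞ := by
      rw [Finset.sum_const, Finset.card_range, ← Nat.cast_smul_eq_nsmul ℝ, smul_smul,
        inv_mul_cancel₀ hn0.ne', one_smul]
    rw [← htel]
    conv_lhs => rw [hg]
    simp only [a, map_smul, map_sum, hu, Finset.sum_sub_distrib, Finset.sum_add_distrib, smul_sub,
      smul_add]
  rw [vanishingRetraction_eq_self hd, norm_sub_rev, hdiff, norm_smul, norm_inv,
    Real.norm_of_nonneg hn0.le, inv_mul_le_iff₀ hn0]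
  refine (hun n).trans ?_
  rw [inv_lt_iff_one_lt_mul₀ hε] at hn
  linarith

end EssentiallyBounded

theorem mainTheorem12 (p : ℝ≥0∞) [Fact (1 ≤ p)] (α : ℝ) (hα0 : 0 < α) (hα1 : α < 1) :
    (p = 1 ∨ p = ∞ →
      UnitBallFailsFPP (LebesgueLp p) (UniformlyHolderNonexpansive α)) ∧
    (1 < p → p < ∞ →
      UnitBallFailsFPP (LebesgueLp p) (HolderNonexpansive α)) := by
  have hp1 : 1 ≤ p := Fact.out
  have hq (hp : p ≠ ∞) : 1 ≤ p.toReal := by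
    simpa using ENNReal.toReal_mono hp hp1
  refine ⟨?_, fun _ hp => ?_⟩
  · rintro (hp | rfl)
    · have hp' : p ≠ ∞ := by rw [hp]; exact ENNReal.one_ne_top
      have hV := norm_smul_rightHalf_add_dilation_rpow hp'
      obtain ⟨T, hfix, hdisp, hT⟩ := exists_holder_of_lipschitz hα0 hα1 two_pos
        (kakutaniMap (hq hp') hV)
        (kakutaniMap_ne_self (hq hp') hV fun _ => eq_zero_of_dilation_eq_self)
        fun _ => exists_norm_sub_kakutaniMap_le (hq hp') hV
      exact ⟨T, fun n hn => hT n hn (dist_iterate_le_of_dist_apply_apply_le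
        (dist_kakutaniMap_le (hq hp') hV)
        (dist_kakutaniMap_kakutaniMap_le (hq hp') hV (by simp [hp])) n hn), hfix, hdisp⟩
    · obtain ⟨T, hfix, hdisp, hT⟩ := exists_holder_of_lipschitz hα0 hα1 four_pos
        shiftMap shiftMap_ne_self fun _ => exists_norm_sub_shiftMap_le
      exact ⟨T, fun n hn => hT n hn (dist_iterate_le_of_dist_apply_apply_le
        dist_shiftMap_le dist_shiftMap_shiftMap_le n hn), hfix, hdisp⟩
  · have hV := norm_smul_rightHalf_add_dilation_rpow hp.ne
    obtain ⟨T, hfix, hdisp, hT⟩ := exists_holder_of_lipschitz hα0 hα1 two_pos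
      (kakutaniMap (hq hp.ne) hV)
      (kakutaniMap_ne_self (hq hp.ne) hV fun _ => eq_zero_of_dilation_eq_self)
      fun _ => exists_norm_sub_kakutaniMap_le (hq hp.ne) hV
    exact ⟨T, hT 1 le_rfl (dist_kakutaniMap_le (hq hp.ne) hV), hfix, hdisp⟩
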